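/- For a group $G$ let $G^{ab}=G/G'$ be its abelianization, and let $G\otimes G$ be its non-abelian tensor square: the group generated by symbols $g\otimes h$ ($g,h\in G$) subject to the relations $$g_1g\otimes h=({}^{g_1}g\otimes{}^{g_1}h)(g_1\otimes h),\qquad g\otimes h_1h=(g\otimes h_1)({}^{h_1}g\otimes{}^{h_1}h)$$ for all $g,g_1,h,h_1\in G$, where ${}^{x}y=xyx^{-1}$. Theorem B. Let $p<q$ be prime numbers and let $G$ be a group of order $p^2q$. (i) If $G^{ab}\cong\mathbb{Z}_{p^2}$, then $G\otimes G\cong\mathbb{Z}_{p^2q}$. (ii) If $G^{ab}\cong\mathbb{Z}_p\times\mathbb{Z}_p$, then $G\otimes G\cong(\mathbb{Z}_p)^4\times\mathbb{Z}_q$. (iii) If $G^{ab}\cong\mathbb{Z}_3$, then $G\cong A_4$ and $G\otimes G\cong\mathbb{Z}_3\times Q_8$, where $Q_8$ is the quaternion group of order $8$. Moreover, if $G$ is nonabelian, then the hypothesis of at least one of (i), (ii), (iii) holds. -/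

import Mathlib

/-- The defining relators of the non-abelian tensor square of `G`, in the free group on the
symbols `g ⊗ h`, the generator `FreeGroup.of (g, h)` standing for `g ⊗ h`. The group `G` acts on
itself by the conjugation `ᵍx = g * x * g⁻¹`, and the relators express
`(g₁ g) ⊗ h = (ᵍ¹g ⊗ ᵍ¹h) (g₁ ⊗ h)` and `g ⊗ (h₁ h) = (g ⊗ h₁) (ʰ¹g ⊗ ʰ¹h)`. -/
inductive TensorSquareRelator (G : Type*) [Group G] : FreeGroup (G × G) → Prop
  | mul_left (g₁ g h : G) : TensorSquareRelator G
      (FreeGroup.of (g₁ * g, h) *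
        (FreeGroup.of (g₁ * g * g₁⁻¹, g₁ * h * g₁⁻¹) * FreeGroup.of (g₁, h))⁻¹)
  | mul_right (g h₁ h : G) : TensorSquareRelator G
      (FreeGroup.of (g, h₁ * h) *
        (FreeGroup.of (g, h₁) * FreeGroup.of (h₁ * g * h₁⁻¹, h₁ * h * h₁⁻¹))⁻¹)

/-- The non-abelian tensor square `G ⊗ G` of a group `G` (Brown–Loday), where `G` acts on itself
by conjugation. -/
abbrev NonabelianTensorSquare (G : Type*) [Group G] : Type _ :=
  PresentedGroup {r : FreeGroup (G × G) | TensorSquareRelator G r}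

/-!
For `X = G ⊗ G`, the commutator map `κ : X → G`, `g ⊗ h ↦ ⁅g, h⁆`, is a crossed module for the
action of `G` on `X` by conjugation: `t y t⁻¹ = ᵏ⁽ᵗ⁾y`, and moreover `g ⊗ κ(t) = ᵍt t⁻¹`. Hence
`ker κ` is central and fixed by `G`. If `L ≤ X` is a `G`-invariant subgroup with `κ(L) = G'`, every
element of `X` is an element of `L` times a fixed point, so `G` acts trivially modulo `L`; then
`X / L` is abelian and is generated by a bilinear image of `Gᵃᵇ × Gᵃᵇ`. This bounds `|X|` by `|L|`
times `n ^ d²`, if `Gᵃᵇ` has `d` generators and exponent `n` (`card_quotient_le`). Surjections from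
`X` onto two groups of coprime orders whose product is that bound then determine `X`
(`nonempty_mulEquiv_of_invariant`). One of the two is always given by products of homomorphisms
`G → ℤ/n` (`pairing`).

* If `|G'| = q` and `|Gᵃᵇ|` is prime to `q`, then `X` is abelian, as `X / ker κ ≅ G'` is cyclic.
  For `T ∈ X` over a generator of `G'` and `g₀ ∈ G` moving it, `u = ᵍ⁰T T⁻¹` has order `q` and
  `L = ⟨u⟩` will do (`exists_invariant_of_card_commutator_prime`). The second surjection is `κ`
  itself, onto `G'`.
* If `G = A₄`, the group `L` is generated by lifts `s₁, s₂, s₃` of the involutions with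
  `sᵢ = sᵢ₊₁ sᵢ₊₂`, so it is a quotient of the quaternion group (`exists_invariant_of_klein`).
  The second surjection takes commutators of lifts to the binary tetrahedral group, a central
  extension of `A₄` with derived subgroup the quaternion group
  (`exists_surjective_quaternionGroup`).

By Sylow's theorems, in a group of order `p² q` with `p < q` either the Sylow `q`-subgroup is normal
with abelian quotient, so that `|G'|` divides `q`, or the group is `A₄`
(`card_commutator_dvd_or_alternatingGroup`).
-/

open scoped commutatorElement

/-! ### The non-abelian tensor square as a crossed module -/


namespace NonabelianTensorSquare

variable {G H : Type*} [Group G] [Group H]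

/-- The generator `g ⊗ h` of the non-abelian tensor square. -/
def tmul (g h : G) : NonabelianTensorSquare G :=
  PresentedGroup.of (g, h)

theorem mul_tmul (g₁ g h : G) :
    tmul (g₁ * g) h = tmul (g₁ * g * g₁⁻¹) (g₁ * h * g₁⁻¹) * tmul g₁ h :=
  PresentedGroup.mk_eq_mk_of_mul_inv_mem (TensorSquareRelator.mul_left g₁ g h)

theorem tmul_mul (g h₁ h : G) :
    tmul g (h₁ * h) = tmul g h₁ * tmul (h₁ * g * h₁⁻¹) (h₁ * h * h₁⁻¹) :=
  PresentedGroup.mk_eq_mk_of_mul_inv_mem (TensorSquareRelator.mul_right g h₁ h)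

@[simp]
theorem tmul_one (g : G) : tmul g 1 = 1 := by
  simpa using tmul_mul g 1 1

/-- The universal property: a crossed pairing `f : G → G → H` induces a homomorphism
`g ⊗ h ↦ f g h`. -/
def lift (f : G → G → H)
    (hl : ∀ g₁ g h, f (g₁ * g) h = f (g₁ * g * g₁⁻¹) (g₁ * h * g₁⁻¹) * f g₁ h)
    (hr : ∀ g h₁ h, f g (h₁ * h) = f g h₁ * f (h₁ * g * h₁⁻¹) (h₁ * h * h₁⁻¹)) :
    NonabelianTensorSquare G →* H :=
  PresentedGroup.toGroup (f := fun x : G × G => f x.1 x.2) <| by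
    rintro _ (⟨g₁, g, h⟩ | ⟨g, h₁, h⟩)
    · simp [hl g₁ g h]
    · simp [hr g h₁ h]

@[simp]
theorem lift_tmul (f : G → G → H) (hl hr) (g h : G) : lift f hl hr (tmul g h) = f g h :=
  PresentedGroup.toGroup.of _

theorem closure_tmul :
    Subgroup.closure (Set.range fun x : G × G => tmul x.1 x.2) = ⊤ :=
  PresentedGroup.closure_range_of _

@[elab_as_elim]
theorem induction {P : NonabelianTensorSquare G → Prop} (tmul : ∀ g h, P (tmul g h))
    (one : P 1) (mul : ∀ x y, P x → P y → P (x * y)) (inv : ∀ x, P x → P x⁻¹)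
    (x : NonabelianTensorSquare G) : P x := by
  have hx : x ∈ Subgroup.closure (Set.range fun x : G × G =>
      NonabelianTensorSquare.tmul x.1 x.2) := by
    rw [closure_tmul]; trivial
  induction hx using Subgroup.closure_induction with
  | mem x hx => obtain ⟨⟨g, h⟩, rfl⟩ := hx; exact tmul g h
  | one => exact one
  | mul x y _ _ hx hy => exact mul x y hx hy
  | inv x _ hx => exact inv x hx

theorem hom_ext {f f' : NonabelianTensorSquare G →* H}
    (h : ∀ g k, f (tmul g k) = f' (tmul g k)) : f = f' :=
  PresentedGroup.ext fun x => h x.1 x.2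

/-- Functoriality of the non-abelian tensor square. -/
def map (f : G →* H) : NonabelianTensorSquare G →* NonabelianTensorSquare H :=
  lift (fun g h => tmul (f g) (f h))
    (fun g₁ g h => by rw [map_mul, mul_tmul]; simp only [map_mul, map_inv])
    (fun g h₁ h => by rw [map_mul, tmul_mul]; simp only [map_mul, map_inv])

@[simp]
theorem map_tmul (f : G →* H) (g h : G) : map f (tmul g h) = tmul (f g) (f h) :=
  lift_tmul ..

/-- Isomorphic groups have isomorphic non-abelian tensor squares. -/
def congr (e : G ≃* H) : NonabelianTensorSquare G ≃* NonabelianTensorSquare H :=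
  MonoidHom.toMulEquiv (map e.toMonoidHom) (map e.symm.toMonoidHom)
    (hom_ext fun g h => by simp) (hom_ext fun g h => by simp)

@[simp]
theorem congr_tmul (e : G ≃* H) (g h : G) : congr e (tmul g h) = tmul (e g) (e h) :=
  map_tmul ..

/-- The action of `G` on `G ⊗ G` induced by conjugation. -/
def act : G →* MulAut (NonabelianTensorSquare G) where
  toFun g := congr (MulAut.conj g)
  map_one' := MulEquiv.toMonoidHom_injective <| hom_ext fun g h => by simp
  map_mul' x y := MulEquiv.toMonoidHom_injective <| hom_ext fun g h => by simp

@[simp]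
theorem act_tmul (x g h : G) :
    act x (tmul g h) = tmul (x * g * x⁻¹) (x * h * x⁻¹) :=
  congr_tmul ..

theorem act_mul_apply (x y : G) (t : NonabelianTensorSquare G) :
    act (x * y) t = act x (act y t) := by
  rw [map_mul, MulAut.mul_apply]

variable (G) in
/-- The commutator map `g ⊗ h ↦ ⁅g, h⁆`. -/
def kappa : NonabelianTensorSquare G →* G :=
  lift (fun g h => ⁅g, h⁆) (fun _ _ _ => by simp only [commutatorElement_def]; group)
    (fun _ _ _ => by simp only [commutatorElement_def]; group)

@[simp]
theorem kappa_tmul (g h : G) : kappa G (tmul g h) = ⁅g, h⁆ :=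
  lift_tmul ..

theorem range_kappa : (kappa G).range = commutator G := by
  rw [MonoidHom.range_eq_map, ← closure_tmul, MonoidHom.map_closure, commutator_eq_closure]
  congr 1
  ext x
  simp [commutatorSet]

theorem kappa_act (x : G) (t : NonabelianTensorSquare G) :
    kappa G (act x t) = x * kappa G t * x⁻¹ := by
  have : (kappa G).comp (act x).toMonoidHom = (MulAut.conj x).toMonoidHom.comp (kappa G) :=
    hom_ext fun g h => by simp
  simpa using DFunLike.congr_fun this t

/-- Expanding `(g * g₁) ⊗ (h * h₁)` in the two possible orders shows that conjugation by `g ⊗ h`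
is the action of `⁅g, h⁆`. -/
theorem tmul_mul_tmul_mul_inv (g h g₁ h₁ : G) :
    tmul g h * tmul g₁ h₁ * (tmul g h)⁻¹ = act ⁅g, h⁆ (tmul g₁ h₁) := by
  have key : ∀ a b : G, act (g * h) (tmul a b) * tmul g h = tmul g h * act (h * g) (tmul a b) := by
    intro a b
    have h1 := mul_tmul g a (h * b)
    have h2 := tmul_mul (g * a) h b
    rw [← act_tmul, tmul_mul a h b, tmul_mul g h b, map_mul, ← act_tmul, ← act_tmul,
      ← act_mul_apply] at h1
    rw [← act_tmul, mul_tmul g a h, mul_tmul g a b, map_mul, ← act_tmul, ← act_tmul,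
      ← act_mul_apply] at h2
    have h3 := h1.symm.trans h2
    simp only [mul_assoc] at h3
    have h4 := mul_left_cancel h3
    simp only [← mul_assoc] at h4
    exact mul_right_cancel h4
  obtain ⟨a, b, hab⟩ : ∃ a b, tmul g₁ h₁ = act (h * g) (tmul a b) :=
    ⟨(h * g)⁻¹ * g₁ * (h * g), (h * g)⁻¹ * h₁ * (h * g), by simp [mul_assoc]⟩
  rw [hab, ← key, mul_inv_cancel_right, ← act_mul_apply]
  simp [commutatorElement_def, mul_assoc]

/-- The Peiffer identity. -/
theorem mul_mul_inv_eq_act (t y : NonabelianTensorSquare G) :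
    t * y * t⁻¹ = act (kappa G t) y := by
  suffices h : ∀ t, MulAut.conj t = act (kappa G t) by
    rw [← h, MulAut.conj_apply]
  intro t
  induction t using NonabelianTensorSquare.induction with
  | tmul g h =>
    refine MulEquiv.toMonoidHom_injective <| hom_ext fun a b => ?_
    simpa only [kappa_tmul] using! tmul_mul_tmul_mul_inv g h a b
  | one => simp
  | mul x y hx hy => simp [hx, hy]
  | inv x hx => simp [hx]

/-- The first defining relation applied to `g * h = h * (h⁻¹ * g * h)`. -/
theorem mul_tmul' (g h k : G) : tmul (g * h) k = tmul g (h * k * h⁻¹) * tmul h k := by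
  simpa [mul_assoc] using mul_tmul h (h⁻¹ * g * h) k

/-- Both sides are crossed homomorphisms in `t`, so it suffices to compare them on generators. -/
theorem tmul_kappa (g : G) (t : NonabelianTensorSquare G) :
    tmul g (kappa G t) = act g t * t⁻¹ := by
  have hmul : ∀ x y, tmul g (kappa G (x * y)) =
      tmul g (kappa G x) * (x * tmul g (kappa G y) * x⁻¹) := fun x y => by
    rw [map_mul, tmul_mul, ← act_tmul, mul_mul_inv_eq_act]
  induction t using NonabelianTensorSquare.induction with
  | tmul h k =>
    have h1 : tmul g (h * k * h⁻¹) =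
        tmul g ⁅h, k⁆ * (tmul h k * tmul g k * (tmul h k)⁻¹) := by
      rw [mul_mul_inv_eq_act, kappa_tmul, act_tmul, ← tmul_mul]
      simp [commutatorElement_def]
    have h2 := (mul_tmul g h k).symm.trans (mul_tmul' g h k)
    rw [h1, ← act_tmul] at h2
    rw [kappa_tmul, eq_mul_inv_iff_mul_eq]
    refine mul_right_cancel (b := tmul g k) (h2.trans ?_).symm
    group
  | one => simp
  | mul x y hx hy => rw [hmul, hx, hy, map_mul]; group
  | inv x hx =>
    have h := hmul x x⁻¹
    rw [mul_inv_cancel, map_one, tmul_one, hx] at h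
    have h' : tmul g (kappa G x⁻¹) = x⁻¹ * (act g x * x⁻¹)⁻¹ * x := by
      rw [← mul_right_inj (act g x * x⁻¹ * x), ← mul_left_inj x⁻¹]
      simpa [mul_assoc] using h.symm
    rw [h', map_inv]
    group

/-- The case `κ(t) = 1` of `g ⊗ κ(t) = ᵍt * t⁻¹`. -/
theorem act_eq_of_kappa_eq_one (g : G) {c : NonabelianTensorSquare G} (hc : kappa G c = 1) :
    act g c = c := by
  have h := tmul_kappa g c
  rw [hc, tmul_one] at h
  exact (mul_inv_eq_one.mp h.symm)

theorem ker_kappa_le_center : (kappa G).ker ≤ Subgroup.center (NonabelianTensorSquare G) := by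
  intro c hc
  rw [Subgroup.mem_center_iff]
  intro y
  have h := mul_mul_inv_eq_act c y
  rw [MonoidHom.mem_ker.mp hc, map_one, MulAut.one_apply, mul_inv_eq_iff_eq_mul] at h
  exact h.symm

/-! ### Bounding the order of the tensor square -/

section Quotient

variable {L : Subgroup (NonabelianTensorSquare G)}

/-- If `L` is a `G`-invariant subgroup with full image in `G'`, then `G` acts trivially modulo `L`,
because every element of `G ⊗ G` is a product of an element of `L` and a fixed point. -/
theorem act_mul_inv_mem (hL : ∀ g, ∀ y ∈ L, act g y ∈ L)
    (hk : ∀ y, ∃ l ∈ L, kappa G l = kappa G y) (g : G) (y : NonabelianTensorSquare G) :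
    act g y * y⁻¹ ∈ L := by
  obtain ⟨l, hl, hly⟩ := hk y
  have hc : kappa G (l⁻¹ * y) = 1 := by rw [map_mul, map_inv, hly, inv_mul_cancel]
  have hy : act g y * y⁻¹ = act g l * l⁻¹ := by
    rw [← mul_inv_cancel_left l y, map_mul, act_eq_of_kappa_eq_one g hc]
    group
  rw [hy]
  exact L.mul_mem (hL g l hl) (L.inv_mem hl)

theorem normal_of_act_mem (hL : ∀ g, ∀ y ∈ L, act g y ∈ L) : L.Normal :=
  ⟨fun y hy t => by rw [mul_mul_inv_eq_act]; exact hL _ y hy⟩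

/-- The quotient `(G ⊗ G) / L` is an abelian group receiving a bilinear pairing from the
abelianization, the image of which generates it. -/
theorem card_quotient_le (hL : ∀ g, ∀ y ∈ L, act g y ∈ L)
    (hk : ∀ y, ∃ l ∈ L, kappa G l = kappa G y) {n : ℕ} (hn : 0 < n)
    (hexp : ∀ a : Abelianization G, a ^ n = 1) (S : Finset (Abelianization G))
    (hS : Subgroup.closure (S : Set (Abelianization G)) = ⊤) :
    0 < Nat.card (NonabelianTensorSquare G ⧸ L) ∧
      Nat.card (NonabelianTensorSquare G ⧸ L) ≤ n ^ (S.card * S.card) := by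
  classical
  have hnorm : L.Normal := normal_of_act_mem hL
  have hmem := act_mul_inv_mem hL hk
  let _ : CommGroup (NonabelianTensorSquare G ⧸ L) :=
    { (inferInstance : Group (NonabelianTensorSquare G ⧸ L)) with
      mul_comm := fun a b => by
        induction a using QuotientGroup.induction_on with | H x =>
        induction b using QuotientGroup.induction_on with | H y =>
        rw [← QuotientGroup.mk_mul, ← QuotientGroup.mk_mul, QuotientGroup.eq_iff_div_mem]
        have := hmem (kappa G x) y
        rw [← mul_mul_inv_eq_act] at this
        simpa [div_eq_mul_inv, mul_assoc] using this }
  let π := QuotientGroup.mk' L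
  have hact : ∀ g y, π (act g y) = π y := fun g y =>
    (QuotientGroup.eq_iff_div_mem).mpr (by rw [div_eq_mul_inv]; exact hmem g y)
  have hmulr : ∀ g h k, π (tmul g (h * k)) = π (tmul g h) * π (tmul g k) := fun g h k => by
    rw [tmul_mul, ← act_tmul, map_mul, hact]
  have hmull : ∀ g h k, π (tmul (g * h) k) = π (tmul g k) * π (tmul h k) := fun g h k => by
    rw [mul_tmul, ← act_tmul, map_mul, hact, mul_comm]
  let B₀ : G →* Abelianization G →* (NonabelianTensorSquare G ⧸ L) :=
    MonoidHom.mk' (fun g => Abelianization.lift (MonoidHom.mk' (fun h => π (tmul g h)) (hmulr g)))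
      fun a b => Abelianization.hom_ext _ _ <| MonoidHom.ext fun c => by simpa using hmull a b c
  let B := Abelianization.lift B₀
  have hB : ∀ g h, B (Abelianization.of g) (Abelianization.of h) = π (tmul g h) := fun g h => by
    simp [B, B₀]
  let T : Finset (NonabelianTensorSquare G ⧸ L) := (S ×ˢ S).image fun x => B x.1 x.2
  have hBmem : ∀ a b, B a b ∈ Subgroup.closure (T : Set (NonabelianTensorSquare G ⧸ L)) := by
    intro a b
    have ha : a ∈ Subgroup.closure (S : Set (Abelianization G)) := by rw [hS]; trivial
    have hb : b ∈ Subgroup.closure (S : Set (Abelianization G)) := by rw [hS]; trivial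
    induction ha using Subgroup.closure_induction with
    | mem a ha =>
      induction hb using Subgroup.closure_induction with
      | mem b hb =>
        refine Subgroup.subset_closure ?_
        simp only [T, Finset.coe_image, Set.mem_image, Finset.mem_coe, Finset.mem_product]
        exact ⟨(a, b), ⟨ha, hb⟩, rfl⟩
      | one => rw [map_one]; exact one_mem _
      | mul x y _ _ hx hy => rw [map_mul]; exact mul_mem hx hy
      | inv x _ hx => rw [map_inv]; exact inv_mem hx
    | one => rw [map_one]; exact one_mem _
    | mul x y _ _ hx hy => rw [map_mul]; exact mul_mem hx hy
    | inv x _ hx => rw [map_inv]; exact inv_mem hx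
  have hT : Subgroup.closure (T : Set (NonabelianTensorSquare G ⧸ L)) = ⊤ := by
    rw [eq_top_iff]
    intro z _
    obtain ⟨y, rfl⟩ := QuotientGroup.mk'_surjective L z
    induction y using NonabelianTensorSquare.induction with
    | tmul g h => exact hB g h ▸ hBmem _ _
    | one => rw [map_one]; exact one_mem _
    | mul x y hx hy => rw [map_mul]; exact mul_mem (hx trivial) (hy trivial)
    | inv x hx => rw [map_inv]; exact inv_mem (hx trivial)
  have hpow : ∀ z : NonabelianTensorSquare G ⧸ L, z ^ n = 1 := by
    intro z
    obtain ⟨y, rfl⟩ := QuotientGroup.mk'_surjective L z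
    induction y using NonabelianTensorSquare.induction with
    | tmul g h =>
      change π (tmul g h) ^ n = 1
      rw [← hB, ← map_pow, hexp, map_one]
    | one => simp
    | mul x y hx hy => rw [map_mul, mul_pow, hx, hy, one_mul]
    | inv x hx => rw [map_inv, inv_pow, hx, inv_one]
  have : Group.FG (NonabelianTensorSquare G ⧸ L) := Group.fg_iff.mpr ⟨T, hT, T.finite_toSet⟩
  have hdvd := card_dvd_exponent_pow_rank' (NonabelianTensorSquare G ⧸ L) hpow
  have hrank : Group.rank (NonabelianTensorSquare G ⧸ L) ≤ S.card * S.card :=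
    (Group.rank_le hT).trans (Finset.card_image_le.trans (Finset.card_product _ _).le)
  have hpos : 0 < n ^ Group.rank (NonabelianTensorSquare G ⧸ L) := pow_pos hn _
  exact ⟨Nat.pos_of_dvd_of_pos hdvd hpos,
    (Nat.le_of_dvd hpos hdvd).trans (Nat.pow_le_pow_right hn hrank)⟩

end Quotient

/-! ### Homomorphisms out of the tensor square -/

/-- Two homomorphisms `η₁, η₂ : G → ℤ/n` induce `g ⊗ h ↦ η₁ g * η₂ h`, the product being that of
the ring `ℤ/n`. -/
def pairing {n : ℕ} (η₁ η₂ : G →* Multiplicative (ZMod n)) :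
    NonabelianTensorSquare G →* Multiplicative (ZMod n) :=
  lift (fun g h => Multiplicative.ofAdd ((η₁ g).toAdd * (η₂ h).toAdd))
    (fun g₁ g h => by simp [← ofAdd_add]; ring_nf)
    (fun g h₁ h => by simp [← ofAdd_add]; ring_nf)

@[simp]
theorem pairing_tmul {n : ℕ} (η₁ η₂ : G →* Multiplicative (ZMod n)) (g h : G) :
    pairing η₁ η₂ (tmul g h) = Multiplicative.ofAdd ((η₁ g).toAdd * (η₂ h).toAdd) :=
  lift_tmul ..

end NonabelianTensorSquare

/-- A group of order at most `|A| * |B|` that maps onto `A` and onto `B`, of coprime orders, is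
`A × B`. -/
theorem nonempty_mulEquiv_prod {X A B : Type*} [Group X] [Group A] [Group B] [Finite X]
    (f : X →* A) (g : X →* B) (hf : Function.Surjective f) (hg : Function.Surjective g)
    (hAB : (Nat.card A).Coprime (Nat.card B)) (hX : Nat.card X ≤ Nat.card A * Nat.card B) :
    Nonempty (X ≃* A × B) := by
  have : Finite A := .of_surjective f hf
  have : Finite B := .of_surjective g hg
  have hdvd : Nat.card (A × B) ∣ Nat.card (f.prod g).range := by
    rw [Nat.card_prod]
    refine hAB.mul_dvd_of_dvd_of_dvd
      (Subgroup.card_dvd_of_surjective ((MonoidHom.fst A B).comp (f.prod g).range.subtype) ?_)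
      (Subgroup.card_dvd_of_surjective ((MonoidHom.snd A B).comp (f.prod g).range.subtype) ?_)
    · intro a
      obtain ⟨x, rfl⟩ := hf a
      exact ⟨⟨f.prod g x, x, rfl⟩, rfl⟩
    · intro b
      obtain ⟨x, rfl⟩ := hg b
      exact ⟨⟨f.prod g x, x, rfl⟩, rfl⟩
  have htop : (f.prod g).range = ⊤ :=
    Subgroup.eq_top_of_le_card _ (Nat.le_of_dvd Nat.card_pos hdvd)
  have hsurj : Function.Surjective (f.prod g) := MonoidHom.range_eq_top.mp htop
  refine ⟨MulEquiv.ofBijective (f.prod g)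
    ((Nat.bijective_iff_surjective_and_card _).mpr ⟨hsurj, ?_⟩)⟩
  rw [Nat.card_prod]
  exact le_antisymm hX (Nat.card_prod A B ▸ Nat.card_le_card_of_surjective _ hsurj)

/-! ### Derived subgroup of prime order -/

theorem mem_zpowers_of_card_commutator_prime {G : Type*} [Group G] {q : ℕ} (hq : q.Prime)
    (hG' : Nat.card (commutator G) = q) {b y : G} (hb : b ∈ commutator G) (hb1 : b ≠ 1)
    (hy : y ∈ commutator G) : ∃ k : ℤ, b ^ k = y := by
  have : Fact q.Prime := ⟨hq⟩
  obtain ⟨k, hk⟩ := mem_zpowers_of_prime_card hG' (g := (⟨b, hb⟩ : commutator G)) (g' := ⟨y, hy⟩)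
    (by simpa [Subtype.ext_iff] using hb1)
  exact ⟨k, by simpa [Subtype.ext_iff] using hk⟩

/-- If `G'` were central, the commutator would be bilinear, hence trivial since the orders of
`G / G'` and `G'` are coprime. -/
theorem not_commutator_le_center {G : Type*} [Group G] {q : ℕ} (hq : q.Prime)
    (hG' : Nat.card (commutator G) = q) {m : ℕ} (hm : Nat.card (Abelianization G) = m)
    (hmq : m.Coprime q) : ¬ commutator G ≤ Subgroup.center G := by
  intro hle
  have hcomm : ∀ a b : G, ⁅a, b⁆ ∈ commutator G := fun a b =>
    Subgroup.commutator_mem_commutator (Subgroup.mem_top a) (Subgroup.mem_top b)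
  have hpow : ∀ a b : G, ∀ n : ℕ, ⁅a ^ n, b⁆ = ⁅a, b⁆ ^ n := by
    intro a b n
    induction n with
    | zero => simp
    | succ n ih =>
      rw [pow_succ', commutatorElement_mul_left_eq_conj_mul, ih, pow_succ,
        Subgroup.mem_center_iff.mp (pow_mem (hle (hcomm a b)) n) a, mul_inv_cancel_right]
  have htriv : ∀ a b : G, ⁅a, b⁆ = 1 := by
    intro a b
    have h1 : ⁅a, b⁆ ^ m = 1 := by
      have ha : a ^ m ∈ commutator G := by
        rw [← Abelianization.ker_of, MonoidHom.mem_ker, map_pow, ← hm, pow_card_eq_one']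
      rw [← hpow, commutatorElement_eq_one_iff_mul_comm]
      exact (Subgroup.mem_center_iff.mp (hle ha) b).symm
    have h2 : ⁅a, b⁆ ^ q = 1 := by
      have := pow_card_eq_one' (x := (⟨⁅a, b⁆, hcomm a b⟩ : commutator G))
      rw [hG'] at this
      simpa [Subtype.ext_iff] using this
    have h3 := pow_gcd_eq_one.mpr ⟨h1, h2⟩
    rwa [hmq.gcd_eq_one, pow_one] at h3
  have hbot : commutator G = ⊥ := by
    rw [commutator_eq_closure, Subgroup.closure_eq_bot_iff]
    rintro _ ⟨a, b, rfl⟩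
    exact htriv a b
  rw [hbot, Subgroup.card_bot] at hG'
  exact hq.ne_one hG'.symm

namespace NonabelianTensorSquare

variable {G : Type*} [Group G]

theorem kappa_mem_commutator (y : NonabelianTensorSquare G) : kappa G y ∈ commutator G :=
  range_kappa (G := G) ▸ ⟨y, rfl⟩

variable (G) in
/-- The commutator map with codomain `G'`. -/
def kappa' : NonabelianTensorSquare G →* commutator G :=
  (kappa G).codRestrict _ kappa_mem_commutator

theorem kappa'_surjective : Function.Surjective (kappa' G) := by
  rintro ⟨b, hb⟩
  rw [← range_kappa] at hb
  obtain ⟨y, rfl⟩ := hb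
  exact ⟨y, rfl⟩

theorem mul_comm_of_isCyclic_commutator [IsCyclic (commutator G)]
    (x y : NonabelianTensorSquare G) : x * y = y * x :=
  ((kappa' G).isMulCommutative_of_isCyclic_of_ker_le_center
    ((MonoidHom.ker_codRestrict _ _ _).trans_le ker_kappa_le_center)).is_comm.comm x y

/-- Let `T` lie over a generator `b` of `G'` and let `g₀` move `b`. As `G ⊗ G` is abelian,
`u = ᵍ⁰T * T⁻¹` satisfies `u ^ q = ᵍ⁰(T ^ q) * (T ^ q)⁻¹ = 1`, and `⟨u⟩` is the required
subgroup. -/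
theorem exists_invariant_of_card_commutator_prime {q : ℕ} (hq : q.Prime)
    (hG' : Nat.card (commutator G) = q) (hZ : ¬ commutator G ≤ Subgroup.center G) :
    ∃ L : Subgroup (NonabelianTensorSquare G), (∀ g, ∀ y ∈ L, act g y ∈ L) ∧
      (∀ y, ∃ l ∈ L, kappa G l = kappa G y) ∧ 0 < Nat.card L ∧ Nat.card L ≤ q := by
  have : Fact q.Prime := ⟨hq⟩
  have : IsCyclic (commutator G) := isCyclic_of_prime_card hG'
  let _ : CommGroup (NonabelianTensorSquare G) :=
    { (inferInstance : Group (NonabelianTensorSquare G)) with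
      mul_comm := mul_comm_of_isCyclic_commutator }
  obtain ⟨b, hb, hbZ⟩ := SetLike.not_le_iff_exists.mp hZ
  obtain ⟨g₀, hg₀⟩ : ∃ g₀, g₀ * b ≠ b * g₀ := by
    simpa [Subgroup.mem_center_iff] using hbZ
  have hb1 : b ≠ 1 := by rintro rfl; simp at hg₀
  obtain ⟨T, hT⟩ : ∃ T, kappa G T = b := by rwa [← range_kappa] at hb
  have hTq : kappa G (T ^ q) = 1 := by
    have := pow_card_eq_one' (x := (⟨b, hb⟩ : commutator G))
    rw [hG'] at this
    rw [map_pow, hT]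
    simpa [Subtype.ext_iff] using this
  set u := act g₀ T * T⁻¹ with hu
  have huq : u ^ q = 1 := by
    rw [hu, mul_pow, ← map_pow, act_eq_of_kappa_eq_one g₀ hTq, inv_pow, mul_inv_cancel]
  have hku : kappa G u ≠ 1 := by
    rw [hu, map_mul, kappa_act, map_inv, hT]
    intro h
    rw [mul_inv_eq_one, mul_inv_eq_iff_eq_mul] at h
    exact hg₀ h
  have hact : ∀ g y, act g (act g₀ y) = act g₀ (act g y) := by
    intro g y
    have h := mul_mul_inv_eq_act (tmul g g₀) (act g₀ (act g y))
    rw [mul_comm, inv_mul_cancel_left, kappa_tmul, ← act_mul_apply, ← act_mul_apply] at h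
    rw [← act_mul_apply, ← act_mul_apply, h]
    simp [commutatorElement_def, mul_assoc]
  have hgu : ∀ g, act g u ∈ Subgroup.zpowers u := by
    intro g
    obtain ⟨k, hk⟩ := mem_zpowers_of_card_commutator_prime hq hG' hb hb1
      (kappa_mem_commutator (act g T))
    obtain ⟨c, hc, hgT⟩ : ∃ c, kappa G c = 1 ∧ act g T = T ^ k * c :=
      ⟨(T ^ k)⁻¹ * act g T, by rw [map_mul, map_inv, map_zpow, hT, hk, inv_mul_cancel], by group⟩
    refine ⟨k, ?_⟩
    change u ^ k = _
    rw [hu, map_mul, hact, map_inv, hgT, map_mul, act_eq_of_kappa_eq_one g₀ hc, map_zpow,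
      mul_zpow, inv_zpow, mul_inv, mul_mul_mul_comm, mul_inv_cancel, mul_one]
  refine ⟨Subgroup.zpowers u, ?_, ?_, ?_, ?_⟩
  · rintro g _ ⟨k, rfl⟩
    change act g (u ^ k) ∈ _
    rw [map_zpow]
    exact zpow_mem (hgu g) k
  · intro y
    obtain ⟨k, hk⟩ := mem_zpowers_of_card_commutator_prime hq hG' (kappa_mem_commutator u) hku
      (kappa_mem_commutator y)
    exact ⟨u ^ k, ⟨k, rfl⟩, by rw [map_zpow, hk]⟩
  · rw [Nat.card_zpowers]
    exact Nat.pos_of_dvd_of_pos (orderOf_dvd_of_pow_eq_one huq) hq.pos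
  · rw [Nat.card_zpowers]
    exact Nat.le_of_dvd hq.pos (orderOf_dvd_of_pow_eq_one huq)

/-- With `d = |S|`, the order of `G ⊗ G` is at most `n ^ d²` times `|L|`; surjections onto groups `A`
and `B` of coprime orders reaching these two factors determine `G ⊗ G`. -/
theorem nonempty_mulEquiv_of_invariant {A B : Type*} [Group A] [Group B]
    {L : Subgroup (NonabelianTensorSquare G)} (hL : ∀ g, ∀ y ∈ L, act g y ∈ L)
    (hk : ∀ y, ∃ l ∈ L, kappa G l = kappa G y) (hL0 : 0 < Nat.card L)
    (hLB : Nat.card L ≤ Nat.card B) {n : ℕ} (hn : 0 < n)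
    (hexp : ∀ a : Abelianization G, a ^ n = 1) (S : Finset (Abelianization G))
    (hS : Subgroup.closure (S : Set (Abelianization G)) = ⊤)
    (hA : n ^ (S.card * S.card) ≤ Nat.card A) (hAB : (Nat.card A).Coprime (Nat.card B))
    (f : NonabelianTensorSquare G →* A) (hf : Function.Surjective f)
    (g : NonabelianTensorSquare G →* B) (hg : Function.Surjective g) :
    Nonempty (NonabelianTensorSquare G ≃* A × B) := by
  obtain ⟨h0, hle⟩ := card_quotient_le hL hk hn hexp S hS
  have hcard := L.card_eq_card_quotient_mul_card_subgroup
  have : Finite (NonabelianTensorSquare G) :=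
    Nat.finite_of_card_ne_zero (hcard ▸ (Nat.mul_pos h0 hL0).ne')
  exact nonempty_mulEquiv_prod f g hf hg hAB
    (hcard.trans_le (Nat.mul_le_mul (hle.trans hA) hLB))

theorem nonempty_mulEquiv_of_card_commutator_prime {A : Type*} [Group A] {q : ℕ} (hq : q.Prime)
    (hG' : Nat.card (commutator G) = q) (hZ : ¬ commutator G ≤ Subgroup.center G) {n : ℕ}
    (hn : 0 < n) (hexp : ∀ a : Abelianization G, a ^ n = 1) (S : Finset (Abelianization G))
    (hS : Subgroup.closure (S : Set (Abelianization G)) = ⊤)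
    (hA : n ^ (S.card * S.card) ≤ Nat.card A) (hAq : (Nat.card A).Coprime q)
    (f : NonabelianTensorSquare G →* A) (hf : Function.Surjective f) :
    Nonempty (NonabelianTensorSquare G ≃* A × Multiplicative (ZMod q)) := by
  have : Fact q.Prime := ⟨hq⟩
  obtain ⟨L, hL, hk, hL0, hLq⟩ := exists_invariant_of_card_commutator_prime hq hG' hZ
  obtain ⟨e⟩ := nonempty_mulEquiv_of_invariant hL hk hL0 (hG'.symm ▸ hLq) hn hexp S hS hA
    (hG'.symm ▸ hAq) f hf (kappa' G) kappa'_surjective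
  have hcard : Nat.card (Multiplicative (ZMod q)) = q := Nat.card_zmod q
  exact ⟨e.trans (MulEquiv.prodCongr (MulEquiv.refl A) (mulEquivOfPrimeCardEq hG' hcard))⟩

theorem pairing_self_surjective {n : ℕ} {η : G →* Multiplicative (ZMod n)}
    (hη : Function.Surjective η) : Function.Surjective (pairing η η) := by
  intro z
  obtain ⟨g, hg⟩ := hη (Multiplicative.ofAdd 1)
  obtain ⟨h, hh⟩ := hη z
  exact ⟨tmul g h, by simp [hg, hh]⟩

theorem closure_singleton_symm_eq_top {A : Type*} [Group A] {n : ℕ}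
    (e : A ≃* Multiplicative (ZMod n)) :
    Subgroup.closure (({e.symm (.ofAdd 1)} : Finset A) : Set A) = ⊤ := by
  rw [Finset.coe_singleton, ← Subgroup.zpowers_eq_closure, Subgroup.eq_top_iff']
  intro a
  refine ⟨((e a).toAdd.cast : ℤ), e.injective ?_⟩
  change e (e.symm (Multiplicative.ofAdd 1) ^ _) = _
  rw [map_zpow, MulEquiv.apply_symm_apply, ← ofAdd_zsmul]
  simp

theorem nonempty_mulEquiv_of_abelianization_cyclic {n q : ℕ} (hn : 0 < n) (hq : q.Prime)
    (hG' : Nat.card (commutator G) = q) (hnq : n.Coprime q)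
    (e : Abelianization G ≃* Multiplicative (ZMod n)) :
    Nonempty (NonabelianTensorSquare G ≃* Multiplicative (ZMod (n * q))) := by
  have hA : Nat.card (Multiplicative (ZMod n)) = n := Nat.card_zmod n
  have hab : Nat.card (Abelianization G) = n := (Nat.card_congr e.toEquiv).trans hA
  let η : G →* Multiplicative (ZMod n) := e.toMonoidHom.comp Abelianization.of
  have hη : Function.Surjective η := e.surjective.comp QuotientGroup.mk_surjective
  obtain ⟨e'⟩ := nonempty_mulEquiv_of_card_commutator_prime (A := Multiplicative (ZMod n)) hq hG'
    (not_commutator_le_center hq hG' hab hnq) hn (fun a => by rw [← hab, pow_card_eq_one'])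
    {e.symm (.ofAdd 1)} (closure_singleton_symm_eq_top e) (by simp [hA]) (by rwa [hA]) (pairing η η)
    (pairing_self_surjective hη)
  exact ⟨e'.trans ((MulEquiv.prodMultiplicative _ _).symm.trans
    (AddEquiv.toMultiplicative (ZMod.chineseRemainder hnq).symm.toAddEquiv))⟩

theorem nonempty_mulEquiv_of_abelianization_prod {p q : ℕ} (hp : p.Prime) (hq : q.Prime)
    (hG' : Nat.card (commutator G) = q) (hpq : p.Coprime q)
    (e : Abelianization G ≃* Multiplicative (ZMod p) × Multiplicative (ZMod p)) :
    Nonempty (NonabelianTensorSquare G ≃*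
      (Fin 4 → Multiplicative (ZMod p)) × Multiplicative (ZMod q)) := by
  classical
  have hA : Nat.card (Multiplicative (ZMod p)) = p := Nat.card_zmod p
  have : NeZero p := ⟨hp.ne_zero⟩
  have hab : Nat.card (Abelianization G) = p * p := by
    rw [Nat.card_congr e.toEquiv, Nat.card_prod, hA]
  have hA4 : Nat.card (Fin 4 → Multiplicative (ZMod p)) = p ^ 4 := by simp
  have hpow : ∀ z : Multiplicative (ZMod p), z ^ p = 1 := fun z => by
    simpa only [hA] using pow_card_eq_one' (x := z)
  let η₁ : G →* Multiplicative (ZMod p) :=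
    (MonoidHom.fst _ _).comp (e.toMonoidHom.comp Abelianization.of)
  let η₂ : G →* Multiplicative (ZMod p) :=
    (MonoidHom.snd _ _).comp (e.toMonoidHom.comp Abelianization.of)
  have hη : ∀ a b, ∃ g, η₁ g = a ∧ η₂ g = b := by
    intro a b
    obtain ⟨g, hg⟩ := (e.surjective.comp QuotientGroup.mk_surjective) (a, b)
    exact ⟨g, congrArg Prod.fst hg, congrArg Prod.snd hg⟩
  let S : Finset (Abelianization G) := {e.symm (.ofAdd 1, 1), e.symm (1, .ofAdd 1)}
  have hScard : S.card ≤ 2 := Finset.card_le_two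
  have hS : Subgroup.closure (S : Set (Abelianization G)) = ⊤ := by
    rw [Subgroup.eq_top_iff']
    intro a
    have ha : a = e.symm (.ofAdd 1, 1) ^ ((e a).1.toAdd.cast : ℤ) *
        e.symm (1, .ofAdd 1) ^ ((e a).2.toAdd.cast : ℤ) := by
      apply e.injective
      simp only [map_mul, map_zpow, MulEquiv.apply_symm_apply]
      ext <;> simp [← ofAdd_zsmul]
    rw [ha]
    exact mul_mem (zpow_mem (Subgroup.subset_closure (by simp [S])) _)
      (zpow_mem (Subgroup.subset_closure (by simp [S])) _)
  refine nonempty_mulEquiv_of_card_commutator_prime hq hG'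
    (not_commutator_le_center hq hG' hab (hpq.mul_left hpq)) hp.pos ?_ S hS ?_ ?_
    (MonoidHom.pi ![pairing η₁ η₁, pairing η₁ η₂, pairing η₂ η₁, pairing η₂ η₂]) ?_
  · intro a
    apply e.injective
    rw [map_pow, map_one]
    exact Prod.ext (hpow _) (hpow _)
  · rw [hA4]
    exact Nat.pow_le_pow_right hp.pos (Nat.mul_le_mul hScard hScard)
  · rw [hA4]
    exact hpq.pow_left 4
  · intro v
    -- With `Gᵃᵇ` written in coordinates, `(1, 0) ⊗ (v 0, v 1)` and `(0, 1) ⊗ (v 2, v 3)` are sent to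
    -- `(v 0, v 1, 0, 0)` and `(0, 0, v 2, v 3)`.
    obtain ⟨g₁, h11, h12⟩ := hη (.ofAdd 1) 1
    obtain ⟨g₂, h21, h22⟩ := hη 1 (.ofAdd 1)
    obtain ⟨k₁, hk11, hk12⟩ := hη (v 0) (v 1)
    obtain ⟨k₂, hk21, hk22⟩ := hη (v 2) (v 3)
    refine ⟨tmul g₁ k₁ * tmul g₂ k₂, ?_⟩
    funext i
    rw [map_mul]
    fin_cases i
    · change pairing η₁ η₁ (tmul g₁ k₁) * pairing η₁ η₁ (tmul g₂ k₂) = v 0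
      simp [h11, h21, hk11]
    · change pairing η₁ η₂ (tmul g₁ k₁) * pairing η₁ η₂ (tmul g₂ k₂) = v 1
      simp [h11, h21, hk12]
    · change pairing η₂ η₁ (tmul g₁ k₁) * pairing η₂ η₁ (tmul g₂ k₂) = v 2
      simp [h12, h22, hk21]
    · change pairing η₂ η₂ (tmul g₁ k₁) * pairing η₂ η₂ (tmul g₂ k₂) = v 3
      simp [h12, h22, hk22]

end NonabelianTensorSquare

/-! ### Generators and relations of the quaternion group -/

/-- The relations `t = s * t * s` and `s = t * s * t` present the quaternion group. -/
theorem QuaternionGroup.exists_hom {X : Type*} [Group X] {s t : X} (h₁ : t = s * t * s)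
    (h₂ : s = t * s * t) :
    ∃ φ : QuaternionGroup 2 →* X, φ (.a 1) = s ∧ φ (.xa 0) = t := by
  have hts : t * s * t⁻¹ = s⁻¹ := by
    rw [mul_inv_eq_iff_eq_mul, eq_inv_mul_iff_mul_eq, ← mul_assoc]; exact h₁.symm
  have htt : t * t = s * s := by
    calc t * t = s * t * s * t := by rw [← h₁]
      _ = s * (t * s * t) := by simp only [mul_assoc]
      _ = s * s := by rw [← h₂]
  have hst : ∀ n : ℤ, s ^ n * t = t * s ^ (-n) := by
    intro n
    have h : t * s ^ n * t⁻¹ = s ^ (-n) := by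
      rw [← MulAut.conj_apply, map_zpow, MulAut.conj_apply, hts, inv_zpow, zpow_neg]
    have h' : t * s ^ (-n) * t⁻¹ = s ^ n := by
      rw [← MulAut.conj_apply, map_zpow, MulAut.conj_apply, hts, inv_zpow, zpow_neg, inv_inv]
    rw [← h', inv_mul_cancel_right]
  have hs4 : s ^ (4 : ℤ) = 1 := by
    have h := hst 2
    have hcomm : s ^ (2 : ℤ) * t = t * s ^ (2 : ℤ) := by
      rw [zpow_two, ← htt, mul_assoc]
    rw [hcomm, mul_right_inj] at h
    calc s ^ (4 : ℤ) = s ^ (2 : ℤ) * s ^ (2 : ℤ) := by rw [← zpow_add]; rfl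
      _ = 1 := by nth_rw 1 [h]; rw [← zpow_add]; simp
  let P : ZMod (2 * 2) →+ Additive X := ZMod.lift (2 * 2) ⟨zmultiplesHom (Additive X) (.ofMul s), by
    change (4 : ℤ) • Additive.ofMul s = 0
    rw [← ofMul_zpow, hs4, ofMul_one]⟩
  have hP : ∀ n : ℤ, (P n).toMul = s ^ n := fun n => by
    simp [P, ZMod.lift_coe]
  have hadd : ∀ i j, (P (i + j)).toMul = (P i).toMul * (P j).toMul := fun i j => by
    rw [map_add, toMul_add]
  have hPt : ∀ i, (P i).toMul * t = t * (P (-i)).toMul := fun i => by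
    obtain ⟨n, rfl⟩ := ZMod.intCast_surjective i
    rw [← Int.cast_neg, hP, hP, hst]
  refine ⟨MonoidHom.mk' (fun z => match z with
      | .a i => (P i).toMul
      | .xa i => t * (P i).toMul) ?_, ?_, ?_⟩
  · rintro (i | i) (j | j)
    · exact hadd i j
    · change t * (P (j - i)).toMul = (P i).toMul * (t * (P j).toMul)
      rw [← mul_assoc, hPt, mul_assoc, ← hadd, neg_add_eq_sub]
    · change t * (P (i + j)).toMul = t * (P i).toMul * (P j).toMul
      rw [hadd, mul_assoc]
    · change (P ((2 : ℕ) + j - i)).toMul = t * (P i).toMul * (t * (P j).toMul)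
      have h2 : (P ((2 : ℕ) : ZMod (2 * 2))).toMul = t * t := by
        rw [htt, ← zpow_two, ← hP]; rfl
      rw [mul_assoc, ← mul_assoc _ t, hPt, mul_assoc, ← hadd, ← mul_assoc, ← h2, ← hadd]
      congr 2
      ring
  · change (P 1).toMul = s
    simpa using hP 1
  · change t * (P 0).toMul = t
    simp

namespace NonabelianTensorSquare

variable {G : Type*} [Group G]

/-! ### The tensor square of the alternating group of degree four -/

/-- Let `G'` be a four-group cyclically permuted by conjugation by `x`, with `G = ⟨G', x⟩`. If `t`
lies over `a`, then `s₃ = ˣt * t⁻¹`, `s₁ = ˣs₃` and `s₂ = ˣs₁` lift the involutions of `G'` and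
satisfy `s₁ = s₂ * s₃`, `s₂ = s₃ * s₁`, `s₃ = s₁ * s₂`, so they generate a quotient of the
quaternion group. -/
theorem exists_invariant_of_klein {a x : G} (hx : x ^ 3 = 1) (ha : a ∈ commutator G)
    (hV : ∀ y ∈ commutator G, y = 1 ∨ y = a ∨ y = x * a * x⁻¹ ∨ y = x ^ 2 * a * (x ^ 2)⁻¹)
    (hmul : x * a * x⁻¹ * a⁻¹ = x ^ 2 * a * (x ^ 2)⁻¹)
    (hG : ∀ g, ∃ v ∈ commutator G, ∃ k : ℕ, g = v * x ^ k) :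
    ∃ L : Subgroup (NonabelianTensorSquare G), (∀ g, ∀ y ∈ L, act g y ∈ L) ∧
      (∀ y, ∃ l ∈ L, kappa G l = kappa G y) ∧ 0 < Nat.card L ∧ Nat.card L ≤ 8 := by
  obtain ⟨t, ht⟩ : ∃ t, kappa G t = a := by rwa [← range_kappa] at ha
  have hx3 : ∀ y, act x (act x (act x y)) = y := fun y => by
    rw [← act_mul_apply, ← act_mul_apply, ← pow_three', hx, map_one, MulAut.one_apply]
  set s₃ := act x t * t⁻¹ with hs₃
  set s₁ := act x s₃ with hs₁
  set s₂ := act x s₁ with hs₂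
  have hs₂' : act x s₂ = s₃ := hx3 s₃
  have hk₃ : kappa G s₃ = x ^ 2 * a * (x ^ 2)⁻¹ := by
    rw [hs₃, map_mul, kappa_act, map_inv, ht, hmul]
  have hk₁ : kappa G s₁ = a := by
    rw [hs₁, kappa_act, hk₃]
    calc x * (x ^ 2 * a * (x ^ 2)⁻¹) * x⁻¹ = x ^ 3 * a * (x ^ 3)⁻¹ := by group
      _ = a := by rw [hx]; group
  have hk₂ : kappa G s₂ = x * a * x⁻¹ := by rw [hs₂, kappa_act, hk₁]
  -- `s₃` and `ˣˣt` lie over the same element of `G'`, so they differ by a fixed point.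
  have hrel₁ : s₁ = s₂ * s₃ := by
    have hc : kappa G ((act x (act x t))⁻¹ * s₃) = 1 := by
      rw [map_mul, map_inv, kappa_act, kappa_act, hk₃, ht, pow_two]; group
    have h := act_eq_of_kappa_eq_one x hc
    rw [map_mul, map_inv, hx3, ← hs₁] at h
    have h12 : s₂ = t * (act x (act x t))⁻¹ := by
      rw [hs₂, hs₁, hs₃, map_mul, map_mul, hx3, map_inv, map_inv]
    rw [h12, mul_assoc, ← h, mul_inv_cancel_left]
  have hrel₂ : s₂ = s₃ * s₁ := by
    have h := congrArg (act x) hrel₁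
    rwa [map_mul, hs₂', ← hs₁, ← hs₂] at h
  have hrel₃ : s₃ = s₁ * s₂ := by
    have h := congrArg (act x) hrel₂
    rwa [map_mul, hs₂', ← hs₁, ← hs₂] at h
  obtain ⟨φ, hφ₁, hφ₂⟩ := QuaternionGroup.exists_hom (s := s₁) (t := s₂)
    (by rw [← hrel₃]; exact hrel₂) (by rw [mul_assoc, ← hrel₃]; exact hrel₁)
  let L := Subgroup.closure {s₁, s₂}
  have h₁ : s₁ ∈ L := Subgroup.subset_closure (by simp)
  have h₂ : s₂ ∈ L := Subgroup.subset_closure (by simp)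
  have h₃ : s₃ ∈ L := hrel₃ ▸ L.mul_mem h₁ h₂
  have hLφ : L ≤ φ.range := by
    rw [Subgroup.closure_le]
    rintro y (rfl | rfl)
    · exact ⟨_, hφ₁⟩
    · exact ⟨_, hφ₂⟩
  have hk : ∀ v ∈ commutator G, ∃ l ∈ L, kappa G l = v := by
    intro v hv
    rcases hV v hv with rfl | rfl | rfl | rfl
    · exact ⟨1, L.one_mem, map_one _⟩
    · exact ⟨s₁, h₁, hk₁⟩
    · exact ⟨s₂, h₂, hk₂⟩
    · exact ⟨s₃, h₃, hk₃⟩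
  have hLx : ∀ y ∈ L, act x y ∈ L := by
    intro y hy
    have hle : L ≤ L.comap (act x).toMonoidHom := by
      refine (Subgroup.closure_le _).mpr ?_
      rintro y (rfl | rfl)
      · exact h₂
      · exact (congrArg (· ∈ L) hs₂').mpr h₃
    exact hle hy
  have hfin : Nat.card φ.range ≤ 8 := by
    have := Nat.card_le_card_of_surjective _ φ.rangeRestrict_surjective
    simpa [QuaternionGroup.card] using this
  have : Finite φ.range := .of_surjective _ φ.rangeRestrict_surjective
  have : Finite L := .of_injective _ (Subgroup.inclusion_injective hLφ)
  refine ⟨L, ?_, fun y => hk _ (kappa_mem_commutator y), Nat.card_pos,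
    (Subgroup.card_le_of_le hLφ).trans hfin⟩
  intro g y hy
  obtain ⟨v, hv, k, rfl⟩ := hG g
  obtain ⟨l, hl, rfl⟩ := hk v hv
  have hxk : act (x ^ k) y ∈ L := by
    induction k with
    | zero => simpa using hy
    | succ k ih => rw [pow_succ', act_mul_apply]; exact hLx _ ih
  rw [act_mul_apply, ← mul_mul_inv_eq_act]
  exact L.mul_mem (L.mul_mem hl hxk) (L.inv_mem hl)

theorem commutatorElement_congr_of_ker_le_center {E : Type*} [Group E] {π : E →* G}
    (hker : π.ker ≤ Subgroup.center E) {e₁ e₂ e₁' e₂' : E} (h₁ : π e₁ = π e₁')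
    (h₂ : π e₂ = π e₂') : ⁅e₁, e₂⁆ = ⁅e₁', e₂'⁆ := by
  have key : ∀ {e e' : E} (f : E), π e = π e' → ⁅e, f⁆ = ⁅e', f⁆ := by
    intro e e' f h
    have hz : e'⁻¹ * e ∈ π.ker := by rw [MonoidHom.mem_ker, map_mul, map_inv, h, inv_mul_cancel]
    have hz' := Subgroup.mem_center_iff.mp (hker hz) f
    rw [← mul_inv_cancel_left e' e, commutatorElement_mul_left_eq_conj_mul,
      commutatorElement_eq_one_iff_mul_comm.mpr hz'.symm]
    group
  rw [key e₂ h₁, ← commutatorElement_inv e₂, key e₁' h₂, commutatorElement_inv]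

/-- A central extension `π : E → G` induces a homomorphism `G ⊗ G → E`, the commutator of
lifts. -/
theorem exists_hom_of_central_extension {E : Type*} [Group E] (π : E →* G)
    (hπ : Function.Surjective π) (hker : π.ker ≤ Subgroup.center E) :
    ∃ ψ : NonabelianTensorSquare G →* E, ∀ e₁ e₂, ψ (tmul (π e₁) (π e₂)) = ⁅e₁, e₂⁆ := by
  let σ := Function.surjInv hπ
  have hσ : ∀ e₁ e₂, ⁅σ (π e₁), σ (π e₂)⁆ = ⁅e₁, e₂⁆ := fun e₁ e₂ =>
    commutatorElement_congr_of_ker_le_center hker (Function.surjInv_eq hπ _)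
      (Function.surjInv_eq hπ _)
  refine ⟨lift (fun g h => ⁅σ g, σ h⁆) ?_ ?_, fun e₁ e₂ => by rw [lift_tmul, hσ]⟩
  · intro g₁ g h
    obtain ⟨g₁, rfl⟩ := hπ g₁
    obtain ⟨g, rfl⟩ := hπ g
    obtain ⟨h, rfl⟩ := hπ h
    simp only [← map_mul, ← map_inv, hσ]
    simp only [commutatorElement_def]; group
  · intro g h₁ h
    obtain ⟨g, rfl⟩ := hπ g
    obtain ⟨h₁, rfl⟩ := hπ h₁
    obtain ⟨h, rfl⟩ := hπ h
    simp only [← map_mul, ← map_inv, hσ]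
    simp only [commutatorElement_def]; group

end NonabelianTensorSquare

/-! ### The binary tetrahedral group -/

namespace BinaryTetrahedral

open QuaternionGroup

/-- The automorphism `i ↦ j ↦ k ↦ i` of the quaternion group, where `i = a 1`, `j = xa 0` and
`k = xa 3`. -/
def rotate : MulAut (QuaternionGroup 2) where
  toFun
    | a m => (![1, xa 0, a 2, xa 2] : Fin 4 → QuaternionGroup 2) m
    | xa m => (![xa 3, a 3, xa 1, a 1] : Fin 4 → QuaternionGroup 2) m
  invFun
    | a m => (![1, xa 3, a 2, xa 1] : Fin 4 → QuaternionGroup 2) m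
    | xa m => (![a 1, xa 2, a 3, xa 0] : Fin 4 → QuaternionGroup 2) m
  left_inv := by decide
  right_inv := by decide
  map_mul' := by decide

theorem rotate_pow_three : rotate ^ 3 = 1 := by
  ext z
  revert z
  decide

/-- The homomorphism from the cyclic group of order three determined by an element of order
dividing three. -/
def ofPowThree {M : Type*} [Group M] (x : M) (hx : x ^ 3 = 1) : Multiplicative (ZMod 3) →* M where
  toFun z := x ^ z.toAdd.val
  map_one' := by simp
  map_mul' y z := by
    rw [toAdd_mul, ZMod.val_add, ← pow_add, ← pow_eq_pow_mod _ hx]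

/-- The binary tetrahedral group, as the extension of the cyclic group of order three by the
quaternion group on which it acts through `rotate`. -/
abbrev _root_.BinaryTetrahedral : Type :=
  QuaternionGroup 2 ⋊[ofPowThree rotate rotate_pow_three] Multiplicative (ZMod 3)

/-- The double transposition `(0 1)(2 3)`. -/
def doubleSwap : alternatingGroup (Fin 4) :=
  ⟨Equiv.swap 0 1 * Equiv.swap 2 3, Equiv.Perm.mem_alternatingGroup.mpr (by decide)⟩

/-- The three-cycle `(0 1 2)`. -/
def threeCycle : alternatingGroup (Fin 4) :=
  ⟨Equiv.swap 0 1 * Equiv.swap 1 2, Equiv.Perm.mem_alternatingGroup.mpr (by decide)⟩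

theorem threeCycle_pow_three : threeCycle ^ 3 = 1 := by
  decide

/-- The quotient map from the quaternion group to the four-group. -/
def toKlein : QuaternionGroup 2 →* alternatingGroup (Fin 4) where
  toFun
    | a m => doubleSwap ^ m.val
    | xa m => threeCycle * doubleSwap * threeCycle⁻¹ * doubleSwap ^ m.val
  map_one' := by decide
  map_mul' := by decide

set_option maxRecDepth 10000 in
theorem toKlein_rotate (z : QuaternionGroup 2) :
    toKlein (rotate z) = threeCycle * toKlein z * threeCycle⁻¹ := by
  revert z
  decide

/-- The double cover of the alternating group `A₄` by the binary tetrahedral group. -/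
def toAlternating : BinaryTetrahedral →* alternatingGroup (Fin 4) :=
  SemidirectProduct.lift toKlein (ofPowThree threeCycle threeCycle_pow_three) (by
    intro g
    ext1 z
    change toKlein ((rotate ^ g.toAdd.val) z) =
      threeCycle ^ g.toAdd.val * toKlein z * (threeCycle ^ g.toAdd.val)⁻¹
    generalize g.toAdd.val = n
    induction n with
    | zero => simp
    | succ n ih => rw [pow_succ', MulAut.mul_apply, toKlein_rotate, ih, pow_succ']; group)

theorem toAlternating_apply (e : BinaryTetrahedral) :
    toAlternating e = toKlein e.left * threeCycle ^ e.right.toAdd.val :=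
  rfl

set_option maxRecDepth 10000 in
theorem toAlternating_surjective : Function.Surjective toAlternating := by
  have h : ∀ g : alternatingGroup (Fin 4), ∃ (z : QuaternionGroup 2) (k : ZMod 3),
      toKlein z * threeCycle ^ k.val = g := by decide
  intro g
  obtain ⟨z, k, h⟩ := h g
  exact ⟨⟨z, .ofAdd k⟩, h⟩

set_option maxRecDepth 10000 in
theorem ker_toAlternating_le_center : toAlternating.ker ≤ Subgroup.center BinaryTetrahedral := by
  have h : ∀ (z : QuaternionGroup 2) (k : ZMod 3), toKlein z * threeCycle ^ k.val = 1 →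
      k = 0 ∧ rotate z = z ∧ ∀ y, y * z = z * y := by decide
  rintro ⟨z, k⟩ he
  obtain ⟨hk, hz, hy⟩ := h z k.toAdd he
  obtain rfl : k = 1 := hk
  have hz' : ∀ n : ℕ, (rotate ^ n) z = z := by
    intro n
    induction n with
    | zero => rfl
    | succ n ih => rw [pow_succ', MulAut.mul_apply, ih, hz]
  rw [Subgroup.mem_center_iff]
  rintro ⟨y, l⟩
  ext1
  · change y * (rotate ^ l.toAdd.val) z = z * (rotate ^ 0) y
    rw [hz', hy]; rfl
  · simp

theorem commutatorElement_inr_inl (z : QuaternionGroup 2) :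
    ⁅(SemidirectProduct.inr (.ofAdd 1) : BinaryTetrahedral),
        (SemidirectProduct.inl z : BinaryTetrahedral)⁆ =
      SemidirectProduct.inl (rotate z * z⁻¹) := by
  rw [commutatorElement_def, ← map_inv SemidirectProduct.inr, ← SemidirectProduct.inl_aut,
    ← map_inv, ← map_mul]
  rfl

/-- The products `j * i⁻¹`, `k * j⁻¹` and `i * k⁻¹` are, up to sign, the three generators. -/
theorem closure_rotate_mul_inv :
    Subgroup.closure (Set.range fun z => rotate z * z⁻¹) = ⊤ := by
  have hmem : ∀ z, rotate z * z⁻¹ ∈ Subgroup.closure (Set.range fun z => rotate z * z⁻¹) :=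
    fun z => Subgroup.subset_closure ⟨z, rfl⟩
  have h : ∀ z : QuaternionGroup 2, ∃ m n : Fin 4,
      z = (rotate (xa 3) * (xa 3)⁻¹) ^ m.val * (rotate (xa 0) * (xa 0)⁻¹) ^ n.val := by decide
  rw [Subgroup.eq_top_iff']
  intro z
  obtain ⟨m, n, rfl⟩ := h z
  exact mul_mem (pow_mem (hmem _) _) (pow_mem (hmem _) _)

end BinaryTetrahedral

namespace NonabelianTensorSquare

open BinaryTetrahedral

/-- Commutators of lifts to the binary tetrahedral group generate its derived subgroup, the
quaternion group. -/
theorem exists_surjective_quaternionGroup :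
    ∃ ψ : NonabelianTensorSquare (alternatingGroup (Fin 4)) →* QuaternionGroup 2,
      Function.Surjective ψ := by
  obtain ⟨ψ, hψ⟩ := exists_hom_of_central_extension toAlternating toAlternating_surjective
    ker_toAlternating_le_center
  have hright : ∀ y, (ψ y).right = 1 := by
    suffices h : SemidirectProduct.rightHom.comp ψ = 1 from DFunLike.congr_fun h
    refine hom_ext fun g h => ?_
    obtain ⟨g, rfl⟩ := toAlternating_surjective g
    obtain ⟨h, rfl⟩ := toAlternating_surjective h
    rw [MonoidHom.comp_apply, hψ, map_commutatorElement, MonoidHom.one_apply,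
      commutatorElement_eq_one_iff_mul_comm, mul_comm]
  let ψ' : NonabelianTensorSquare (alternatingGroup (Fin 4)) →* QuaternionGroup 2 :=
    MonoidHom.mk' (fun y => (ψ y).left) fun y z => by
      rw [map_mul, SemidirectProduct.mul_left, hright, map_one, MulAut.one_apply]
  refine ⟨ψ', MonoidHom.range_eq_top.mp (top_le_iff.mp ?_)⟩
  rw [← closure_rotate_mul_inv, Subgroup.closure_le]
  rintro _ ⟨z, rfl⟩
  refine ⟨tmul (toAlternating (SemidirectProduct.inr (.ofAdd 1)))
    (toAlternating (SemidirectProduct.inl z)), ?_⟩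
  change (ψ _).left = _
  rw [hψ, commutatorElement_inr_inl, SemidirectProduct.left_inl]

set_option maxRecDepth 10000 in
theorem alternatingGroup_exists_invariant :
    ∃ L : Subgroup (NonabelianTensorSquare (alternatingGroup (Fin 4))),
      (∀ g, ∀ y ∈ L, act g y ∈ L) ∧ (∀ y, ∃ l ∈ L, kappa _ l = kappa _ y) ∧
      0 < Nat.card L ∧ Nat.card L ≤ 8 := by
  have hcomm : ∀ g h : alternatingGroup (Fin 4), ⁅g, h⁆ ∈ toKlein.range := by
    have h : ∀ g h : alternatingGroup (Fin 4), ∃ z, toKlein z = ⁅g, h⁆ := by decide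
    exact h
  have hle : commutator (alternatingGroup (Fin 4)) ≤ toKlein.range := by
    rw [commutator_eq_closure, Subgroup.closure_le]
    rintro _ ⟨g, h, rfl⟩
    exact hcomm g h
  have hz : ∀ z, ∃ g h : alternatingGroup (Fin 4), ⁅g, h⁆ = toKlein z := by decide
  have hmem : ∀ z, toKlein z ∈ commutator (alternatingGroup (Fin 4)) := by
    intro z
    obtain ⟨g, h, hgh⟩ := hz z
    exact hgh ▸ Subgroup.commutator_mem_commutator (Subgroup.mem_top g) (Subgroup.mem_top h)
  refine exists_invariant_of_klein (a := doubleSwap) (x := threeCycle) threeCycle_pow_three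
    (hmem (.a 1)) ?_ (by decide) ?_
  · have h : ∀ z, toKlein z = 1 ∨ toKlein z = doubleSwap ∨
        toKlein z = threeCycle * doubleSwap * threeCycle⁻¹ ∨
        toKlein z = threeCycle ^ 2 * doubleSwap * (threeCycle ^ 2)⁻¹ := by decide
    intro y hy
    obtain ⟨z, rfl⟩ := hle hy
    exact h z
  · intro g
    obtain ⟨e, rfl⟩ := toAlternating_surjective g
    exact ⟨_, hmem e.left, _, toAlternating_apply e⟩

theorem nonempty_mulEquiv_of_equiv_alternatingGroup {G : Type*} [Group G]
    (e : G ≃* alternatingGroup (Fin 4))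
    (hG : Nonempty (Abelianization G ≃* Multiplicative (ZMod 3))) :
    Nonempty (NonabelianTensorSquare G ≃* Multiplicative (ZMod 3) × QuaternionGroup 2) := by
  obtain ⟨f⟩ := hG
  let f' := e.abelianizationCongr.symm.trans f
  obtain ⟨L, hL, hk, hL0, hL8⟩ := alternatingGroup_exists_invariant
  obtain ⟨ψ, hψ⟩ := exists_surjective_quaternionGroup
  have hA : Nat.card (Multiplicative (ZMod 3)) = 3 := Nat.card_zmod 3
  have hB : Nat.card (QuaternionGroup 2) = 8 := by simp [QuaternionGroup.card]
  have hab : Nat.card (Abelianization (alternatingGroup (Fin 4))) = 3 :=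
    (Nat.card_congr f'.toEquiv).trans hA
  let η := f'.toMonoidHom.comp Abelianization.of
  have hη : Function.Surjective η := f'.surjective.comp QuotientGroup.mk_surjective
  obtain ⟨e'⟩ := nonempty_mulEquiv_of_invariant hL hk hL0 (hB.symm ▸ hL8) (n := 3) (by decide)
    (fun a => by rw [← hab, pow_card_eq_one']) _ (closure_singleton_symm_eq_top f')
    (by simp) (by rw [hA, hB]; decide) (pairing η η) (pairing_self_surjective hη) ψ hψ
  exact ⟨(congr e).trans e'⟩

end NonabelianTensorSquare

/-! ### Groups of order `p ^ 2 * q` -/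

/-- Acting on its four Sylow `3`-subgroups embeds the group in the symmetric group of degree four as
a subgroup of index two: each Sylow subgroup is its own normalizer, and these meet trivially. -/
theorem nonempty_mulEquiv_alternatingGroup {G : Type*} [Group G] (hG : Nat.card G = 12)
    (hS : Nat.card (Sylow 3 G) = 4) : Nonempty (G ≃* alternatingGroup (Fin 4)) := by
  have : Fact (Nat.Prime 3) := ⟨Nat.prime_three⟩
  have : Finite G := Nat.finite_of_card_ne_zero (by rw [hG]; decide)
  have hcard : ∀ P : Sylow 3 G, Nat.card P = 3 := by
    intro P
    have h3 : (12 : ℕ).factorization 3 = 1 := by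
      rw [show (12 : ℕ) = 3 * 4 from rfl, Nat.factorization_mul (by decide) (by decide)]
      simp [Nat.prime_three.factorization_self,
        Nat.factorization_eq_zero_of_not_dvd (show ¬ 3 ∣ 4 by decide)]
    rw [P.card_eq_multiplicity, hG, h3, pow_one]
  have hnorm : ∀ P : Sylow 3 G, Subgroup.normalizer (P : Set G) = P := by
    intro P
    have h1 := P.card_eq_index_normalizer
    have h2 := (Subgroup.normalizer (P : Set G)).card_mul_index
    rw [← h1, hS, hG] at h2
    have h3 : Nat.card (Subgroup.normalizer (P : Set G)) = 3 := by omega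
    exact (Subgroup.eq_of_le_of_card_ge Subgroup.le_normalizer (h3.trans (hcard P).symm).le).symm
  let σ := MulAction.toPermHom G (Sylow 3 G)
  have hker : ∀ P : Sylow 3 G, σ.ker ≤ P := by
    intro P g hg
    rw [← hnorm P, ← Sylow.smul_eq_iff_mem_normalizer]
    exact DFunLike.congr_fun (MonoidHom.mem_ker.mp hg) P
  have hinj : Function.Injective σ := by
    rw [← MonoidHom.ker_eq_bot_iff]
    obtain ⟨P⟩ : Nonempty (Sylow 3 G) := inferInstance
    rcases (Nat.dvd_prime Nat.prime_three).mp (hcard P ▸ Subgroup.card_dvd_of_le (hker P)) with h | h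
    · exact Subgroup.card_eq_one.mp h
    · have heq : ∀ P : Sylow 3 G, σ.ker = P := fun P =>
        Subgroup.eq_of_le_of_card_ge (hker P) (by rw [hcard, h])
      have : Subsingleton (Sylow 3 G) :=
        ⟨fun P Q => Sylow.ext ((heq P).symm.trans (heq Q))⟩
      rw [Nat.card_of_subsingleton P] at hS
      omega
  let e : Sylow 3 G ≃ Fin 4 := Nat.equivFinOfCardPos (by rw [hS]; decide) |>.trans (finCongr hS)
  let τ : G →* Equiv.Perm (Fin 4) := e.permCongrHom.toMonoidHom.comp σ
  have hτ : Function.Injective τ := e.permCongrHom.injective.comp hinj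
  have hrange : τ.range = alternatingGroup (Fin 4) := by
    refine Equiv.Perm.eq_alternatingGroup_of_index_eq_two ?_
    have h := τ.range.card_mul_index
    have hP : Nat.card (Equiv.Perm (Fin 4)) = 24 := by
      rw [Nat.card_eq_fintype_card, Fintype.card_perm]; rfl
    rw [← Nat.card_congr (MonoidHom.ofInjective hτ).toEquiv, hG, hP] at h
    omega
  exact ⟨(MonoidHom.ofInjective hτ).trans (MulEquiv.subgroupCongr hrange)⟩

/-- The number of Sylow `q`-subgroups divides `p ^ 2` and is congruent to `1` modulo `q`. It is
either `1`, and then the quotient by the Sylow subgroup has order `p ^ 2` and is abelian, or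
`p ^ 2`, which forces `q = p + 1`. -/
theorem card_commutator_dvd_or_alternatingGroup {G : Type*} [Group G] {p q : ℕ} (hp : p.Prime)
    (hq : q.Prime) (hpq : p < q) (hG : Nat.card G = p ^ 2 * q) :
    Nat.card (commutator G) ∣ q ∨ p = 2 ∧ q = 3 ∧ Nonempty (G ≃* alternatingGroup (Fin 4)) := by
  have : Fact p.Prime := ⟨hp⟩
  have : Fact q.Prime := ⟨hq⟩
  have hG0 : Nat.card G ≠ 0 := by
    rw [hG]; exact mul_ne_zero (pow_ne_zero 2 hp.ne_zero) hq.ne_zero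
  have : Finite G := Nat.finite_of_card_ne_zero hG0
  obtain ⟨Q⟩ : Nonempty (Sylow q G) := inferInstance
  have hcop : ¬ q ∣ p ^ 2 := fun h =>
    absurd (Nat.le_of_dvd hp.pos (hq.dvd_of_dvd_pow h)) (not_le.mpr hpq)
  have hQ : Nat.card Q = q := by
    rw [Q.card_eq_multiplicity, hG, Nat.factorization_mul (pow_ne_zero 2 hp.ne_zero) hq.ne_zero]
    rw [Finsupp.add_apply, Nat.factorization_eq_zero_of_not_dvd hcop, hq.factorization_self, zero_add,
      pow_one]
  have hindex : (Q : Subgroup G).index = p ^ 2 := by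
    have h := (Q : Subgroup G).card_mul_index
    rw [hQ, hG, mul_comm] at h
    exact Nat.eq_of_mul_eq_mul_right hq.pos h
  have hmod := card_sylow_modEq_one q G
  obtain ⟨i, hi, hn⟩ := (Nat.dvd_prime_pow hp).mp (hindex ▸ Q.card_dvd_index)
  interval_cases i
  · left
    have : Subsingleton (Sylow q G) := (Nat.card_eq_one_iff_unique.mp (by simpa using hn)).1
    have : (Q : Subgroup G).Normal := Q.normal_of_subsingleton
    have hab : Nat.card (G ⧸ (Q : Subgroup G)) = p ^ 2 := hindex
    have hle : commutator G ≤ Q := by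
      rw [commutator_eq_closure, Subgroup.closure_le]
      rintro _ ⟨g, h, rfl⟩
      refine (QuotientGroup.eq_one_iff _).mp ?_
      rw [← QuotientGroup.mk'_apply, map_commutatorElement, commutatorElement_eq_one_iff_mul_comm]
      exact (IsPGroup.isMulCommutative_of_card_eq_prime_sq hab).is_comm.comm _ _
    exact hQ ▸ Subgroup.card_dvd_of_le hle
  · exfalso
    rw [hn, pow_one, Nat.ModEq, Nat.mod_eq_of_lt hpq, Nat.mod_eq_of_lt hq.one_lt] at hmod
    exact hp.ne_one hmod
  · right
    have hdvd : q ∣ (p + 1) * (p - 1) := by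
      rw [hn] at hmod
      have := (Nat.modEq_iff_dvd' (Nat.one_le_pow 2 p hp.pos)).mp hmod.symm
      rwa [← one_pow 2, Nat.sq_sub_sq] at this
    have hp2 := hp.two_le
    have hqp : q = p + 1 := by
      rcases hq.dvd_mul.mp hdvd with h | h
      · exact le_antisymm (Nat.le_of_dvd (by omega) h) hpq
      · have := Nat.le_of_dvd (by omega) h
        omega
    have hp' : p = 2 := by
      rcases hp.eq_two_or_odd with h | h
      · exact h
      · rcases hq.eq_two_or_odd with h' | h' <;> omega
    subst hp' hqp
    exact ⟨rfl, rfl, nonempty_mulEquiv_alternatingGroup hG hn⟩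

theorem nonempty_addEquiv_prod_of_card_sq (V : Type*) [AddCommGroup V] (p : ℕ) [Fact p.Prime]
    [Module (ZMod p) V] (hV : Nat.card V = p ^ 2) : Nonempty (V ≃+ ZMod p × ZMod p) := by
  have hp : p.Prime := Fact.out
  have : Finite V := Nat.finite_of_card_ne_zero (hV ▸ pow_ne_zero 2 hp.ne_zero)
  have hfin : Module.finrank (ZMod p) V = 2 := by
    have h := Module.natCard_eq_pow_finrank (K := ZMod p) (V := V)
    rw [Nat.card_zmod, hV] at h
    exact (Nat.pow_right_injective hp.two_le h).symm
  have hfin' : Module.finrank (ZMod p) (ZMod p × ZMod p) = 2 := by simp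
  exact ⟨(LinearEquiv.ofFinrankEq V (ZMod p × ZMod p) (hfin.trans hfin'.symm)).toAddEquiv⟩

/-- A noncyclic group of order `p ^ 2` has exponent `p`, so it is a vector space of dimension two
over `ZMod p`. -/
theorem nonempty_mulEquiv_of_card_prime_sq {A : Type*} [CommGroup A] {p : ℕ} (hp : p.Prime)
    (hA : Nat.card A = p ^ 2) :
    Nonempty (A ≃* Multiplicative (ZMod (p ^ 2))) ∨
      Nonempty (A ≃* Multiplicative (ZMod p) × Multiplicative (ZMod p)) := by
  have : Fact p.Prime := ⟨hp⟩
  by_cases hcyc : IsCyclic A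
  · left
    rw [← hA]
    exact ⟨(zmodCyclicMulEquiv hcyc).symm⟩
  · right
    have hexp := (not_isCyclic_iff_exponent_eq_prime hp hA).mp hcyc
    have hsmul : ∀ x : Additive A, p • x = 0 := fun x => by
      change Additive.ofMul (x.toMul ^ p) = 0
      rw [← hexp, Monoid.pow_exponent_eq_one, ofMul_one]
    let _ : Module (ZMod p) (Additive A) := AddCommGroup.zmodModule hsmul
    obtain ⟨e⟩ := nonempty_addEquiv_prod_of_card_sq (Additive A) p
      ((Nat.card_congr Additive.toMul).trans hA)
    exact ⟨(AddEquiv.toMultiplicativeRight e).trans (MulEquiv.prodMultiplicative _ _)⟩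

theorem card_abelianization_alternatingGroup :
    Nat.card (Abelianization (alternatingGroup (Fin 4))) = 3 := by
  have h4 : Nat.card (Fin 4) = 4 := Nat.card_fin 4
  have h := (commutator (alternatingGroup (Fin 4))).card_eq_card_quotient_mul_card_subgroup
  rw [← alternatingGroup.kleinFour_eq_commutator h4,
    alternatingGroup.kleinFour_card_of_card_eq_four h4,
    alternatingGroup.card_of_card_eq_four h4] at h
  change Nat.card (_ ⧸ commutator _) = 3
  rw [← alternatingGroup.kleinFour_eq_commutator h4]
  omega

theorem theoremB {G : Type*} [Group G] (p q : ℕ) (hp : p.Prime) (hq : q.Prime) (hpq : p < q)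
    (hG : Nat.card G = p ^ 2 * q) :
    -- if `G` is nonabelian, then one of the three cases occurs
    ((∃ a b : G, a * b ≠ b * a) →
      Nonempty (Abelianization G ≃* Multiplicative (ZMod (p ^ 2))) ∨
      Nonempty (Abelianization G ≃* Multiplicative (ZMod p) × Multiplicative (ZMod p)) ∨
      Nonempty (Abelianization G ≃* Multiplicative (ZMod 3))) ∧
    -- (i)
    (Nonempty (Abelianization G ≃* Multiplicative (ZMod (p ^ 2))) →
      Nonempty (NonabelianTensorSquare G ≃* Multiplicative (ZMod (p ^ 2 * q)))) ∧
    -- (ii)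
    (Nonempty (Abelianization G ≃* Multiplicative (ZMod p) × Multiplicative (ZMod p)) →
      Nonempty (NonabelianTensorSquare G ≃*
        (Fin 4 → Multiplicative (ZMod p)) × Multiplicative (ZMod q))) ∧
    -- (iii)
    (Nonempty (Abelianization G ≃* Multiplicative (ZMod 3)) →
      Nonempty (G ≃* alternatingGroup (Fin 4)) ∧
      Nonempty (NonabelianTensorSquare G ≃* Multiplicative (ZMod 3) × QuaternionGroup 2)) := by
  have hG0 : Nat.card G ≠ 0 := by
    rw [hG]; exact mul_ne_zero (pow_ne_zero 2 hp.ne_zero) hq.ne_zero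
  have hcard : p ^ 2 * q = Nat.card (Abelianization G) * Nat.card (commutator G) :=
    hG ▸ (commutator G).card_eq_card_quotient_mul_card_subgroup
  have hcop : p.Coprime q := (Nat.coprime_primes hp hq).mpr hpq.ne
  have hZ : ∀ n, Nat.card (Multiplicative (ZMod n)) = n := Nat.card_zmod
  have hG' : Nat.card (Abelianization G) = p ^ 2 → Nat.card (commutator G) = q := fun h =>
    (Nat.eq_of_mul_eq_mul_left (pow_pos hp.pos 2) (h ▸ hcard)).symm
  have hstruct := card_commutator_dvd_or_alternatingGroup hp hq hpq hG
  refine ⟨?_, ?_, ?_, ?_⟩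
  · rintro ⟨a, b, hab⟩
    rcases hstruct with h | ⟨-, -, ⟨e⟩⟩
    · have hne : Nat.card (commutator G) ≠ 1 := by
        intro h1
        have hmem : ⁅a, b⁆ ∈ commutator G :=
          Subgroup.commutator_mem_commutator (Subgroup.mem_top a) (Subgroup.mem_top b)
        rw [Subgroup.card_eq_one.mp h1, Subgroup.mem_bot,
          commutatorElement_eq_one_iff_mul_comm] at hmem
        exact hab hmem
      rw [((Nat.dvd_prime hq).mp h).resolve_left hne] at hcard
      have h2 := Nat.eq_of_mul_eq_mul_right hq.pos hcard
      rcases nonempty_mulEquiv_of_card_prime_sq hp h2.symm with h | h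
      · exact .inl h
      · exact .inr (.inl h)
    · have : Fact (Nat.Prime 3) := ⟨Nat.prime_three⟩
      exact .inr (.inr ⟨e.abelianizationCongr.trans
        (mulEquivOfPrimeCardEq card_abelianization_alternatingGroup (hZ 3))⟩)
  · rintro ⟨e⟩
    exact NonabelianTensorSquare.nonempty_mulEquiv_of_abelianization_cyclic (pow_pos hp.pos 2) hq
      (hG' ((Nat.card_congr e.toEquiv).trans (hZ _))) (hcop.pow_left 2) e
  · rintro ⟨e⟩
    refine NonabelianTensorSquare.nonempty_mulEquiv_of_abelianization_prod hp hq (hG' ?_) hcop e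
    rw [Nat.card_congr e.toEquiv, Nat.card_prod, hZ, pow_two]
  · intro h
    obtain ⟨e⟩ : Nonempty (G ≃* alternatingGroup (Fin 4)) := by
      rcases hstruct with hdvd | ⟨-, -, e⟩
      · exfalso
        obtain ⟨e⟩ := h
        rw [Nat.card_congr e.toEquiv, hZ] at hcard
        have hp2 := hp.two_le
        have hpp : 4 ≤ p ^ 2 := Nat.pow_le_pow_left hp2 2
        have hle : Nat.card (commutator G) ≤ q := Nat.le_of_dvd hq.pos hdvd
        have hq0 := hq.pos
        nlinarith
      · exact e
    exact ⟨⟨e⟩, NonabelianTensorSquare.nonempty_mulEquiv_of_equiv_alternatingGroup e h⟩
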